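/- Let $\mathbb{K}$ be a field of characteristic zero, let $n,r\ge 0$ be integers, and let $f=(f_1,\dots,f_r)$ be an $r$-tuple of nonzero polynomials in $\mathbb{K}[x]=\mathbb{K}[x_1,\dots,x_n]$. Let $D_n$ be the $n$-th Weyl algebra over $\mathbb{K}$, with generators $x_m,\partial_m$ ($1\le m\le n$) and $\partial_i x_j=x_j\partial_i+\delta_{ij}$, the $x_m$ commuting with each other and the $\partial_m$ commuting with each other. Let $\mathbb{K}\langle S\rangle=U(\mathfrak{gl}_r)$ be the universal enveloping algebra generated by $S=(s_{ij})_{1\le i,j\le r}$ with $[s_{ij},s_{kl}]=\delta_{jk}s_{il}-\delta_{il}s_{kj}$, and put $D_n\langle S\rangle=D_n\otimes_{\mathbb{K}}\mathbb{K}\langle S\rangle$. Let $D_n\langle\partial t,S\rangle$ be the $\mathbb{K}$-algebra generated by $x_m,\partial_m,\partial t_k,s_{ij}$ subject to the relations above, to the relations that the $\partial t_k$ commute with each other and with $D_n$ and that the $s_{ij}$ commute with $D_n$, and to $[s_{ij},\partial t_k]=\delta_{jk}\,\partial t_i$; it contains $D_n\langle S\rangle$ as a subalgebra. Let $M=\mathbb{K}[x,s,\tfrac{1}{f_1\cdots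 f_r}]\cdot f^s$, with $s=(s_1,\dots,s_r)$, be the free module of rank one on the symbol $f^s=f_1^{s_1}\cdots f_r^{s_r}$, viewed as a left $D_n\langle S\rangle$-module in which $x_m$ acts by multiplication and $$\partial_m\bullet(G(s)f^s)=\Big(\frac{\partial G}{\partial x_m}+G\sum_{j=1}^r s_j\frac{\partial f_j}{\partial x_m}\frac1{f_j}\Big)f^s,\qquad s_{ij}\bullet(G(s)f^s)=s_i\,G(s+\epsilon_j-\epsilon_i)\,\frac{f_j}{f_i}\,f^s\quad(1\le i,j\le r),$$ where $\epsilon_j$ is the $j$-th unit vector. Then the annihilator of $f^s$, i.e. the left ideal $\{P\in D_n\langle S\rangle: P\bullet f^s=0\}$, equals $$\Big[\,D_n\langle\partial t,S\rangle\Big(s_{ij}+\partial t_i f_j,\ \partial_m+\sum_{k=1}^r\frac{\partial f_k}{\partial x_m}\partial t_k\ \Big|\ 1\le i,j\le r,\ 1\le m\le n\Big)\Big]\cap D_n\langle S\rangle,$$ where the bracket denotes the left ideal of $D_n\langle\partial t,S\rangle$ generated by the listed elements. -/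

import Mathlib

open scoped TensorProduct

noncomputable section

namespace BMVar

/-! ### The Weyl algebra -/

section Weyl

variable (K : Type*) [Field K] (n : ℕ)

/-- Generators of the `n`-th Weyl algebra: `x_m` and `∂_m`. -/
inductive WeylGen (n : ℕ) : Type
  | x (m : Fin n) : WeylGen n
  | d (m : Fin n) : WeylGen n

/-- Defining relations of the `n`-th Weyl algebra for given elements `X m`, `D m` of a ring: the
`X m` commute, the `D m` commute, and `D_i X_j = X_j D_i + δ_ij`. -/
inductive WeylRelOn {A : Type*} [Ring A] {n : ℕ} (X D : Fin n → A) : A → A → Prop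
  | x_x (i j : Fin n) : WeylRelOn X D (X i * X j) (X j * X i)
  | d_d (i j : Fin n) : WeylRelOn X D (D i * D j) (D j * D i)
  | d_x (i j : Fin n) : WeylRelOn X D (D i * X j) (X j * D i + if i = j then 1 else 0)

/-- Defining relations of the `n`-th Weyl algebra between the generators `x_m`, `∂_m`. -/
abbrev WeylRel : FreeAlgebra K (WeylGen n) → FreeAlgebra K (WeylGen n) → Prop :=
  WeylRelOn (fun m => FreeAlgebra.ι K (.x m)) (fun m => FreeAlgebra.ι K (.d m))

/-- The `n`-th Weyl algebra `D_n` over `K`. -/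
abbrev Weyl : Type _ := RingQuot (WeylRel K n)

variable {K n}

/-- The algebra homomorphism out of `D_n` given by the images `X m`, `D m` of `x_m`, `∂_m`. -/
def weylLift {C : Type*} [Ring C] [Algebra K C] (X D : Fin n → C)
    (hXX : ∀ i j, X i * X j = X j * X i) (hDD : ∀ i j, D i * D j = D j * D i)
    (hDX : ∀ i j, D i * X j = X j * D i + if i = j then 1 else 0) : Weyl K n →ₐ[K] C :=
  RingQuot.liftAlgHom K
    ⟨FreeAlgebra.lift K fun g => match g with
      | .x m => X m
      | .d m => D m, by
      intro a b h
      cases h with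
      | x_x i j => simpa using hXX i j
      | d_d i j => simpa using hDD i j
      | d_x i j =>
        have := hDX i j
        split_ifs at this ⊢ <;> simpa using this⟩

/-- If the generators `x_m`, `∂_m` are mapped into a subalgebra, then so is all of `D_n`. -/
theorem weyl_map_mem {C : Type*} [Ring C] [Algebra K C] (φ : Weyl K n →ₐ[K] C)
    (A : Subalgebra K C)
    (h : ∀ g, φ (RingQuot.mkAlgHom K (WeylRel K n) (FreeAlgebra.ι K g)) ∈ A) (w : Weyl K n) :
    φ w ∈ A := by
  obtain ⟨a, rfl⟩ := RingQuot.mkAlgHom_surjective K (WeylRel K n) w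
  induction a using FreeAlgebra.induction with
  | grade0 c => rw [AlgHom.commutes, AlgHom.commutes]; exact A.algebraMap_mem c
  | grade1 g => exact h g
  | mul a b ha hb => rw [map_mul, map_mul]; exact A.mul_mem ha hb
  | add a b ha hb => rw [map_add, map_add]; exact A.add_mem ha hb

end Weyl

/-! ### The enveloping algebra of `gl_r` and `D_n⟨S⟩` -/

section Gl

attribute [local instance 100] LieRing.ofAssociativeRing

variable (K : Type*) [Field K] (n r : ℕ)

/-- `K⟨S⟩`, the universal enveloping algebra `U(gl_r)`. -/
abbrev UGl : Type _ := UniversalEnvelopingAlgebra K (Matrix (Fin r) (Fin r) K)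

variable {r}

/-- The generator `s_ij` of `U(gl_r)`, i.e. the image of the matrix unit `E_ij`. -/
def UGl.s (i j : Fin r) : UGl K r := UniversalEnvelopingAlgebra.ι K (Matrix.single i j (1 : K))

variable (r)

/-- `D_n⟨S⟩ = D_n ⊗ U(gl_r)`. -/
abbrev DnS : Type _ := Weyl K n ⊗[K] UGl K r

variable {K n r}

theorem UGl.s_s (i j k l : Fin r) :
    UGl.s K i j * UGl.s K k l - UGl.s K k l * UGl.s K i j =
      (if j = k then UGl.s K i l else 0) - (if i = l then UGl.s K k j else 0) := by
  rw [← Ring.lie_def]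
  simp only [UGl.s]
  rw [← LieHom.map_lie, Ring.lie_def, map_sub]
  congr 1
  · split_ifs with h
    · subst h
      rw [Matrix.single_mul_single_same, one_mul]
    · rw [Matrix.single_mul_single_of_ne _ _ _ _ h, map_zero]
  · split_ifs with h
    · subst h
      rw [Matrix.single_mul_single_same, one_mul]
    · rw [Matrix.single_mul_single_of_ne _ _ _ _ (Ne.symm h), map_zero]

/-- The linear map out of `gl_r` sending each matrix unit `E_ij` to `σ i j`. -/
def glLinear {C : Type*} [Ring C] [Algebra K C] (σ : Fin r → Fin r → C) :
    Matrix (Fin r) (Fin r) K →ₗ[K] C where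
  toFun A := ∑ i, ∑ j, A i j • σ i j
  map_add' A B := by simp [add_smul, Finset.sum_add_distrib]
  map_smul' c A := by simp [Finset.smul_sum, mul_smul]

theorem glLinear_single {C : Type*} [Ring C] [Algebra K C] (σ : Fin r → Fin r → C)
    (i j : Fin r) (c : K) : glLinear σ (Matrix.single i j c) = c • σ i j := by
  change ∑ i', ∑ j', (Matrix.single i j c) i' j' • σ i' j' = _
  rw [Finset.sum_eq_single i, Finset.sum_eq_single j]
  · simp
  · intro b _ hb
    simp [hb.symm]
  · simp
  · intro b _ hb
    simp [hb.symm]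
  · simp

/-- The algebra homomorphism out of `U(gl_r)` given by the images `σ i j` of the `s_ij`. -/
def glLift {C : Type*} [Ring C] [Algebra K C] (σ : Fin r → Fin r → C)
    (hσ : ∀ i j k l, σ i j * σ k l - σ k l * σ i j =
      (if j = k then σ i l else 0) - (if i = l then σ k j else 0)) : UGl K r →ₐ[K] C :=
  UniversalEnvelopingAlgebra.lift K
    { glLinear σ with
      map_lie' := by
        intro A B
        change glLinear σ ⁅A, B⁆ = ⁅glLinear σ A, glLinear σ B⁆
        induction A using Matrix.induction_on' with
        | h_zero => simp
        | h_add p q hp hq => rw [add_lie, map_add, map_add, add_lie, hp, hq]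
        | h_std_basis i j a =>
          induction B using Matrix.induction_on' with
          | h_zero => simp
          | h_add p q hp hq => rw [lie_add, map_add, map_add, lie_add, hp, hq]
          | h_std_basis k l b =>
            rw [Ring.lie_def, Ring.lie_def, map_sub, glLinear_single, glLinear_single,
              smul_mul_smul_comm, smul_mul_smul_comm, mul_comm b a, ← smul_sub, hσ, smul_sub]
            congr 1
            · split_ifs with h
              · subst h
                rw [Matrix.single_mul_single_same, glLinear_single]
              · rw [Matrix.single_mul_single_of_ne _ _ _ _ h, map_zero, smul_zero]
            · split_ifs with h
              · subst h
                rw [Matrix.single_mul_single_same, glLinear_single, mul_comm]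
              · rw [Matrix.single_mul_single_of_ne _ _ _ _ (Ne.symm h), map_zero, smul_zero] }

theorem glLift_s {C : Type*} [Ring C] [Algebra K C] (σ : Fin r → Fin r → C)
    (hσ : ∀ i j k l, σ i j * σ k l - σ k l * σ i j =
      (if j = k then σ i l else 0) - (if i = l then σ k j else 0)) (i j : Fin r) :
    glLift (K := K) σ hσ (UGl.s K i j) = σ i j := by
  rw [glLift, UGl.s, UniversalEnvelopingAlgebra.lift_ι_apply]
  change glLinear σ _ = _
  rw [glLinear_single, one_smul]

/-- Two algebra homomorphisms out of `U(gl_r)` that agree on the `s_ij` are equal. -/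
theorem gl_hom_ext {C : Type*} [Ring C] [Algebra K C] {φ ψ : UGl K r →ₐ[K] C}
    (h : ∀ i j, φ (UGl.s K i j) = ψ (UGl.s K i j)) : φ = ψ := by
  apply UniversalEnvelopingAlgebra.hom_ext
  ext A
  change φ (UniversalEnvelopingAlgebra.ι K A) = ψ (UniversalEnvelopingAlgebra.ι K A)
  induction A using Matrix.induction_on' with
  | h_zero => simp
  | h_add p q hp hq => simp only [map_add, hp, hq]
  | h_std_basis i j a =>
    have e : Matrix.single i j a = a • Matrix.single i j (1 : K) := by simp
    have := h i j
    simp only [UGl.s] at this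
    rw [e, map_smul, map_smul, map_smul, this]

/-- If the generators `s_ij` are mapped into a subalgebra, then so is all of `U(gl_r)`. -/
theorem glLift_mem {C : Type*} [Ring C] [Algebra K C] (σ : Fin r → Fin r → C)
    (hσ : ∀ i j k l, σ i j * σ k l - σ k l * σ i j =
      (if j = k then σ i l else 0) - (if i = l then σ k j else 0))
    (A : Subalgebra K C) (h : ∀ i j, σ i j ∈ A) (u : UGl K r) : glLift σ hσ u ∈ A := by
  have hσ' : ∀ i j k l, (⟨σ i j, h i j⟩ : A) * ⟨σ k l, h k l⟩ - ⟨σ k l, h k l⟩ * ⟨σ i j, h i j⟩ =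
      (if j = k then (⟨σ i l, h i l⟩ : A) else 0) - (if i = l then ⟨σ k j, h k j⟩ else 0) := by
    intro i j k l
    apply Subtype.ext
    have := hσ i j k l
    split_ifs at this ⊢ <;> simpa using this
  have e : glLift σ hσ = A.val.comp (glLift (fun i j => (⟨σ i j, h i j⟩ : A)) hσ') :=
    gl_hom_ext fun i j => by
      rw [glLift_s, AlgHom.comp_apply, glLift_s]
      rfl
  rw [e]
  exact (glLift (fun i j => (⟨σ i j, h i j⟩ : A)) hσ' u).2

/-- The algebra homomorphism out of `D_n⟨S⟩ = D_n ⊗ U(gl_r)` given by the images of the generators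
`x_m`, `∂_m`, `s_ij`. -/
def dnsLift {C : Type*} [Ring C] [Algebra K C] (X D : Fin n → C)
    (hXX : ∀ i j, X i * X j = X j * X i) (hDD : ∀ i j, D i * D j = D j * D i)
    (hDX : ∀ i j, D i * X j = X j * D i + if i = j then 1 else 0)
    (σ : Fin r → Fin r → C)
    (hσ : ∀ i j k l, σ i j * σ k l - σ k l * σ i j =
      (if j = k then σ i l else 0) - (if i = l then σ k j else 0))
    (hXσ : ∀ m i j, X m * σ i j = σ i j * X m) (hDσ : ∀ m i j, D m * σ i j = σ i j * D m) :
    DnS K n r →ₐ[K] C :=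
  Algebra.TensorProduct.lift (weylLift X D hXX hDD hDX) (glLift σ hσ) fun w u =>
    show Commute _ _ by
    have hu : glLift (K := K) σ hσ u ∈
        Subalgebra.centralizer K (Set.range X ∪ Set.range D) := by
      refine glLift_mem σ hσ _ (fun i j => ?_) u
      rw [Subalgebra.mem_centralizer_iff]
      rintro _ (⟨m, rfl⟩ | ⟨m, rfl⟩)
      · exact hXσ m i j
      · exact hDσ m i j
    rw [Subalgebra.mem_centralizer_iff] at hu
    have hw : weylLift (K := K) X D hXX hDD hDX w ∈ Subalgebra.centralizer K {glLift σ hσ u} := by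
      refine weyl_map_mem _ _ (fun g => ?_) w
      rw [weylLift, RingQuot.liftAlgHom_mkAlgHom_apply, Subalgebra.mem_centralizer_iff]
      rintro _ rfl
      cases g with
      | x m => simpa using (hu _ (Or.inl ⟨m, rfl⟩)).symm
      | d m => simpa using (hu _ (Or.inr ⟨m, rfl⟩)).symm
    rw [Subalgebra.mem_centralizer_iff] at hw
    exact (hw _ rfl).symm

end Gl

/-! ### The algebra `D_n⟨∂t, S⟩` -/

section DntS

/-- Generators of `D_n⟨∂t, S⟩`: `x_m`, `∂_m`, `∂t_k` and `s_ij`. -/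
inductive Gen (n r : ℕ) : Type
  | x (m : Fin n) : Gen n r
  | d (m : Fin n) : Gen n r
  | dt (k : Fin r) : Gen n r
  | s (i j : Fin r) : Gen n r

variable (K : Type*) [Field K] (n r : ℕ)

/-- Defining relations of `D_n⟨∂t, S⟩` for given elements `X m`, `D m`, `T k`, `σ i j` of a ring:
those of `D_n` for `X`, `D`, the `T k` commute with each other and with `X`, `D`, the `σ i j`
commute with `X`, `D`, and
`[σ_ij, T_k] = δ_jk T_i`, `[σ_ij, σ_kl] = δ_jk σ_il - δ_il σ_kj`. -/
inductive RelOn {A : Type*} [Ring A] {n r : ℕ} (X D : Fin n → A) (T : Fin r → A)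
    (σ : Fin r → Fin r → A) : A → A → Prop
  | x_x (i j : Fin n) : RelOn X D T σ (X i * X j) (X j * X i)
  | d_d (i j : Fin n) : RelOn X D T σ (D i * D j) (D j * D i)
  | d_x (i j : Fin n) : RelOn X D T σ (D i * X j) (X j * D i + if i = j then 1 else 0)
  | dt_dt (k l : Fin r) : RelOn X D T σ (T k * T l) (T l * T k)
  | dt_x (k : Fin r) (m : Fin n) : RelOn X D T σ (T k * X m) (X m * T k)
  | dt_d (k : Fin r) (m : Fin n) : RelOn X D T σ (T k * D m) (D m * T k)
  | x_s (m : Fin n) (i j : Fin r) : RelOn X D T σ (X m * σ i j) (σ i j * X m)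
  | d_s (m : Fin n) (i j : Fin r) : RelOn X D T σ (D m * σ i j) (σ i j * D m)
  | s_dt (i j k : Fin r) :
      RelOn X D T σ (σ i j * T k - T k * σ i j) (if j = k then T i else 0)
  | s_s (i j k l : Fin r) :
      RelOn X D T σ (σ i j * σ k l - σ k l * σ i j)
        ((if j = k then σ i l else 0) - (if i = l then σ k j else 0))

/-- Defining relations of `D_n⟨∂t, S⟩` between the generators `x_m`, `∂_m`, `∂t_k`, `s_ij`. -/
abbrev Rel : FreeAlgebra K (Gen n r) → FreeAlgebra K (Gen n r) → Prop :=
  RelOn (fun m => FreeAlgebra.ι K (.x m)) (fun m => FreeAlgebra.ι K (.d m))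
    (fun k => FreeAlgebra.ι K (.dt k)) (fun i j => FreeAlgebra.ι K (.s i j))

/-- The algebra `D_n⟨∂t, S⟩`. -/
abbrev DntS : Type _ := RingQuot (Rel K n r)

variable {n r}

/-- The generators `x_m`, `∂_m`, `∂t_k`, `s_ij` as elements of `D_n⟨∂t, S⟩`. -/
def gen (g : Gen n r) : DntS K n r := RingQuot.mkAlgHom K (Rel K n r) (FreeAlgebra.ι K g)

theorem gen_x_x (i j : Fin n) :
    gen K (.x i : Gen n r) * gen K (.x j) = gen K (.x j) * gen K (.x i) := by
  simpa [gen] using RingQuot.mkAlgHom_rel K (s := Rel K n r) (RelOn.x_x i j)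

theorem gen_d_d (i j : Fin n) :
    gen K (.d i : Gen n r) * gen K (.d j) = gen K (.d j) * gen K (.d i) := by
  simpa [gen] using RingQuot.mkAlgHom_rel K (s := Rel K n r) (RelOn.d_d i j)

theorem gen_d_x (i j : Fin n) :
    gen K (.d i : Gen n r) * gen K (.x j) =
      gen K (.x j) * gen K (.d i) + if i = j then 1 else 0 := by
  have := RingQuot.mkAlgHom_rel K (s := Rel K n r) (RelOn.d_x i j)
  split_ifs at this ⊢ <;> simpa [gen] using this

theorem gen_x_s (m : Fin n) (i j : Fin r) :
    gen K (.x m : Gen n r) * gen K (.s i j) = gen K (.s i j) * gen K (.x m) := by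
  simpa [gen] using RingQuot.mkAlgHom_rel K (s := Rel K n r) (RelOn.x_s m i j)

theorem gen_d_s (m : Fin n) (i j : Fin r) :
    gen K (.d m : Gen n r) * gen K (.s i j) = gen K (.s i j) * gen K (.d m) := by
  simpa [gen] using RingQuot.mkAlgHom_rel K (s := Rel K n r) (RelOn.d_s m i j)

theorem gen_s_s (i j k l : Fin r) :
    gen K (.s i j : Gen n r) * gen K (.s k l) - gen K (.s k l) * gen K (.s i j) =
      (if j = k then gen K (.s i l : Gen n r) else 0) - (if i = l then gen K (.s k j) else 0) := by
  have := RingQuot.mkAlgHom_rel K (s := Rel K n r) (RelOn.s_s i j k l)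
  split_ifs at this ⊢ <;> simpa [gen] using this

variable (n r)

/-- The canonical homomorphism `D_n⟨S⟩ → D_n⟨∂t, S⟩`, which fixes `x_m`, `∂_m` and `s_ij`. -/
def incl : DnS K n r →ₐ[K] DntS K n r :=
  dnsLift (fun m => gen K (.x m)) (fun m => gen K (.d m)) (gen_x_x K) (gen_d_d K) (gen_d_x K)
    (fun i j => gen K (.s i j)) (gen_s_s K) (gen_x_s K) (gen_d_s K)

variable {n r}

theorem incl_x (m : Fin n) : incl K n r
    (RingQuot.mkAlgHom K (WeylRel K n) (FreeAlgebra.ι K (.x m)) ⊗ₜ 1) = gen K (.x m) := by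
  simp [incl, dnsLift, weylLift]

theorem incl_d (m : Fin n) : incl K n r
    (RingQuot.mkAlgHom K (WeylRel K n) (FreeAlgebra.ι K (.d m)) ⊗ₜ 1) = gen K (.d m) := by
  simp [incl, dnsLift, weylLift]

theorem incl_s (i j : Fin r) : incl K n r (1 ⊗ₜ UGl.s K i j) = gen K (.s i j) := by
  rw [incl, dnsLift, Algebra.TensorProduct.lift_tmul, map_one, one_mul, glLift_s]

variable {K} in
/-- The algebra homomorphism out of `D_n⟨∂t, S⟩` given by the images of the generators. -/
def dntsLift {C : Type*} [Ring C] [Algebra K C] (X D : Fin n → C) (T : Fin r → C)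
    (σ : Fin r → Fin r → C)
    (hXX : ∀ i j, X i * X j = X j * X i) (hDD : ∀ i j, D i * D j = D j * D i)
    (hDX : ∀ i j, D i * X j = X j * D i + if i = j then 1 else 0)
    (hTT : ∀ k l, T k * T l = T l * T k) (hTX : ∀ k m, T k * X m = X m * T k)
    (hTD : ∀ k m, T k * D m = D m * T k)
    (hXσ : ∀ m i j, X m * σ i j = σ i j * X m) (hDσ : ∀ m i j, D m * σ i j = σ i j * D m)
    (hσT : ∀ i j k, σ i j * T k - T k * σ i j = if j = k then T i else 0)
    (hσ : ∀ i j k l, σ i j * σ k l - σ k l * σ i j =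
      (if j = k then σ i l else 0) - (if i = l then σ k j else 0)) : DntS K n r →ₐ[K] C :=
  RingQuot.liftAlgHom K
    ⟨FreeAlgebra.lift K fun g => match g with
      | .x m => X m
      | .d m => D m
      | .dt k => T k
      | .s i j => σ i j, by
      intro a b h
      cases h with
      | x_x i j => simpa using hXX i j
      | d_d i j => simpa using hDD i j
      | d_x i j =>
        have := hDX i j
        split_ifs at this ⊢ <;> simpa using this
      | dt_dt k l => simpa using hTT k l
      | dt_x k m => simpa using hTX k m
      | dt_d k m => simpa using hTD k m
      | x_s m i j => simpa using hXσ m i j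
      | d_s m i j => simpa using hDσ m i j
      | s_dt i j k =>
        have := hσT i j k
        split_ifs at this ⊢ <;> simpa using this
      | s_s i j k l =>
        have := hσ i j k l
        split_ifs at this ⊢ <;> simpa using this⟩

/-- `D_n⟨S⟩` is a subalgebra of `D_n⟨∂t, S⟩`: setting all `∂t_k` to `0` is a left inverse of the
canonical homomorphism. -/
theorem incl_injective : Function.Injective (incl K n r) := by
  let xW (m : Fin n) : Weyl K n := RingQuot.mkAlgHom K (WeylRel K n) (FreeAlgebra.ι K (.x m))
  let dW (m : Fin n) : Weyl K n := RingQuot.mkAlgHom K (WeylRel K n) (FreeAlgebra.ι K (.d m))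
  have hxx (i j : Fin n) : xW i * xW j = xW j * xW i := by
    simpa [xW] using RingQuot.mkAlgHom_rel K (s := WeylRel K n) (WeylRelOn.x_x i j)
  have hdd (i j : Fin n) : dW i * dW j = dW j * dW i := by
    simpa [dW] using RingQuot.mkAlgHom_rel K (s := WeylRel K n) (WeylRelOn.d_d i j)
  have hdx (i j : Fin n) : dW i * xW j = xW j * dW i + if i = j then 1 else 0 := by
    have := RingQuot.mkAlgHom_rel K (s := WeylRel K n) (WeylRelOn.d_x i j)
    split_ifs at this ⊢ <;> simpa [xW, dW] using this
  let p : Weyl K n →ₐ[K] DnS K n r := Algebra.TensorProduct.includeLeft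
  let q : UGl K r →ₐ[K] DnS K n r := Algebra.TensorProduct.includeRight
  have hpq (w : Weyl K n) (u : UGl K r) : p w * q u = q u * p w := by
    change (w ⊗ₜ[K] (1 : UGl K r)) * ((1 : Weyl K n) ⊗ₜ[K] u) = (1 ⊗ₜ u) * (w ⊗ₜ 1)
    rw [Algebra.TensorProduct.tmul_mul_tmul, Algebra.TensorProduct.tmul_mul_tmul, one_mul, mul_one,
      one_mul, mul_one]
  let ρ : DntS K n r →ₐ[K] DnS K n r := dntsLift (fun m => p (xW m)) (fun m => p (dW m))
    (fun _ => 0) (fun i j => q (UGl.s K i j))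
    (fun i j => by rw [← map_mul, hxx, map_mul])
    (fun i j => by rw [← map_mul, hdd, map_mul])
    (fun i j => by
      rw [← map_mul, hdx, map_add, map_mul, apply_ite p, map_one, map_zero])
    (fun _ _ => rfl)
    (fun _ _ => by rw [zero_mul, mul_zero]) (fun _ _ => by rw [zero_mul, mul_zero])
    (fun m i j => hpq _ _) (fun m i j => hpq _ _)
    (fun _ _ _ => by rw [zero_mul, mul_zero, sub_zero, ite_self])
    (fun i j k l => by
      rw [← map_mul, ← map_mul, ← map_sub, UGl.s_s, map_sub, apply_ite q, apply_ite q, map_zero])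
  have h : ρ.comp (incl K n r) = AlgHom.id K (DnS K n r) := by
    apply Algebra.TensorProduct.ext
    · apply RingQuot.ringQuot_ext'
      apply FreeAlgebra.hom_ext
      funext g
      cases g with
      | x m =>
        change ρ (incl K n r (xW m ⊗ₜ 1)) = xW m ⊗ₜ 1
        rw [incl_x]
        exact (RingQuot.liftAlgHom_mkAlgHom_apply _ _ _ _).trans (FreeAlgebra.lift_ι_apply _ _)
      | d m =>
        change ρ (incl K n r (dW m ⊗ₜ 1)) = dW m ⊗ₜ 1
        rw [incl_d]
        exact (RingQuot.liftAlgHom_mkAlgHom_apply _ _ _ _).trans (FreeAlgebra.lift_ι_apply _ _)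
    · refine gl_hom_ext (K := K) (C := DnS K n r)
        (φ := (ρ.comp (incl K n r)).comp Algebra.TensorProduct.includeRight)
        (ψ := Algebra.TensorProduct.includeRight) fun i j => ?_
      change ρ (incl K n r (1 ⊗ₜ UGl.s K i j)) = 1 ⊗ₜ UGl.s K i j
      rw [incl_s]
      exact (RingQuot.liftAlgHom_mkAlgHom_apply _ _ _ _).trans (FreeAlgebra.lift_ι_apply _ _)
  exact Function.LeftInverse.injective (g := ρ) fun a => congrArg (fun φ => φ a) h

/-- The homomorphism `K[x_1, …, x_n] → D_n⟨∂t, S⟩` with `x_m ↦ x_m`. -/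
def polyHom : MvPolynomial (Fin n) K →ₐ[K] DntS K n r :=
  letI : CommRing (Algebra.adjoin K (Set.range fun m => gen K (.x m : Gen n r))) :=
    { (Algebra.adjoin K (Set.range fun m => gen K (.x m : Gen n r))).toRing with
      mul_comm := (Algebra.isMulCommutative_adjoin K
        (by rintro _ ⟨i, rfl⟩ _ ⟨j, rfl⟩; exact gen_x_x K i j)).is_comm.comm }
  (Algebra.adjoin K (Set.range fun m => gen K (.x m : Gen n r))).val.comp
    (MvPolynomial.aeval fun m => ⟨gen K (.x m), Algebra.subset_adjoin ⟨m, rfl⟩⟩)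

theorem polyHom_X (m : Fin n) :
    polyHom K (MvPolynomial.X m) = gen K (.x m : Gen n r) := by
  simp [polyHom]

variable {K}

/-- The left ideal of `D_n⟨∂t, S⟩` generated by all `s_ij + ∂t_i f_j` and all
`∂_m + ∑_k (∂f_k/∂x_m) ∂t_k`. -/
def bmIdeal (f : Fin r → MvPolynomial (Fin n) K) : Ideal (DntS K n r) :=
  Ideal.span
    ((Set.range fun p : Fin r × Fin r =>
        gen K (.s p.1 p.2) + gen K (.dt p.1) * polyHom K (f p.2)) ∪
      (Set.range fun m : Fin n =>
        gen K (.d m) + ∑ k : Fin r, polyHom K (MvPolynomial.pderiv m (f k)) * gen K (.dt k)))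

end DntS

/-! ### The module `M = K[x, s, 1/f] · f^s` -/

section Localization

variable {K P : Type*} [Field K] [CommRing P] [Algebra K P] (W : Submonoid P)
  (L : Type*) [CommRing L] [Algebra P L] [Algebra K L] [IsScalarTower K P L] [IsLocalization W L]

/-- The homomorphism `p ↦ p + ε D(p)` to the dual numbers over `L`. -/
def dualHom (D : Derivation K P P) : P →+* TrivSqZeroExt L L where
  toFun p := TrivSqZeroExt.inl (algebraMap P L p) + TrivSqZeroExt.inr (algebraMap P L (D p))
  map_one' := by rw [map_one, Derivation.map_one_eq_zero, map_zero]; simp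
  map_zero' := by rw [map_zero, map_zero, map_zero]; simp
  map_add' a b := by
    rw [map_add, map_add, map_add, TrivSqZeroExt.inl_add, TrivSqZeroExt.inr_add]; abel
  map_mul' a b := by
    rw [Derivation.leibniz, smul_eq_mul, smul_eq_mul, map_add, map_mul, map_mul, map_mul]
    ext
    · simp only [TrivSqZeroExt.fst_add, TrivSqZeroExt.fst_mul, TrivSqZeroExt.fst_inl,
        TrivSqZeroExt.fst_inr, add_zero]
    · simp only [TrivSqZeroExt.snd_add, TrivSqZeroExt.snd_mul, TrivSqZeroExt.snd_inl,
        TrivSqZeroExt.snd_inr, TrivSqZeroExt.fst_add, TrivSqZeroExt.fst_inl,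
        TrivSqZeroExt.fst_inr, add_zero, zero_add, op_smul_eq_smul, smul_eq_mul]

theorem dualHom_isUnit (D : Derivation K P P) (w : W) : IsUnit (dualHom L D w) := by
  rw [TrivSqZeroExt.isUnit_iff_isUnit_fst]
  simpa [dualHom] using IsLocalization.map_units L w

theorem fst_lift_dualHom (D : Derivation K P P) (a : L) :
    (IsLocalization.lift (dualHom_isUnit W L D) a).fst = a := by
  have : (TrivSqZeroExt.fstHom L L L).toRingHom.comp
      (IsLocalization.lift (dualHom_isUnit W L D)) = RingHom.id _ := by
    apply IsLocalization.ringHom_ext W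
    ext p
    simp [dualHom]
  exact congrArg (fun φ => φ a) this

theorem snd_lift_dualHom (D : Derivation K P P) (p : P) :
    (IsLocalization.lift (dualHom_isUnit W L D) (algebraMap P L p)).snd =
      algebraMap P L (D p) := by
  rw [IsLocalization.lift_eq]
  exact zero_add _

/-- The unique extension of a derivation of `P` to a localization `L` of `P`. -/
def locDer (D : Derivation K P P) : Derivation K L L :=
  Derivation.mk'
    { toFun := fun a => (IsLocalization.lift (dualHom_isUnit W L D) a).snd
      map_add' := fun a b => by rw [map_add, TrivSqZeroExt.snd_add]
      map_smul' := fun c a => by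
        rw [Algebra.smul_def, map_mul, IsScalarTower.algebraMap_apply K P L,
          TrivSqZeroExt.snd_mul, fst_lift_dualHom, fst_lift_dualHom, snd_lift_dualHom,
          Derivation.map_algebraMap, map_zero, smul_zero, add_zero, RingHom.id_apply,
          ← IsScalarTower.algebraMap_apply, smul_eq_mul, ← Algebra.smul_def] }
    (fun a b => by
      change (IsLocalization.lift (dualHom_isUnit W L D) (a * b)).snd =
        a • (IsLocalization.lift (dualHom_isUnit W L D) b).snd +
        b • (IsLocalization.lift (dualHom_isUnit W L D) a).snd
      rw [map_mul, TrivSqZeroExt.snd_mul, fst_lift_dualHom, fst_lift_dualHom,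
        op_smul_eq_smul])

theorem locDer_algebraMap (D : Derivation K P P) (p : P) :
    locDer W L D (algebraMap P L p) = algebraMap P L (D p) :=
  snd_lift_dualHom W L D p

end Localization

section Module

variable {K : Type*} [Field K] {n r : ℕ}

/-- `f_j` as an element of `K[x, s]`; the variables are `x_m = X (inl m)` and
`s_i = X (inr i)`. -/
def fXS (f : Fin r → MvPolynomial (Fin n) K) (j : Fin r) : MvPolynomial (Fin n ⊕ Fin r) K :=
  MvPolynomial.rename Sum.inl (f j)

/-- The powers of `f_1 ⋯ f_r` in `K[x, s]`. -/
abbrev fPow (f : Fin r → MvPolynomial (Fin n) K) :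
    Submonoid (MvPolynomial (Fin n ⊕ Fin r) K) :=
  Submonoid.powers (∏ j, fXS f j)

/-- The canonical homomorphism from `K[x, s]` to `L = K[x, s, 1/f]`. -/
abbrev toL (L : Type*) [CommRing L]
    [Algebra (MvPolynomial (Fin n ⊕ Fin r) K) L] [Algebra K L]
    [IsScalarTower K (MvPolynomial (Fin n ⊕ Fin r) K) L] : MvPolynomial (Fin n ⊕ Fin r) K →ₐ[K] L :=
  IsScalarTower.toAlgHom K (MvPolynomial (Fin n ⊕ Fin r) K) L

/-- The variable `x_m` in `K[x, s, 1/f]`. -/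
def xL (_f : Fin r → MvPolynomial (Fin n) K) (L : Type*) [CommRing L]
    [Algebra (MvPolynomial (Fin n ⊕ Fin r) K) L] [Algebra K L]
    [IsScalarTower K (MvPolynomial (Fin n ⊕ Fin r) K) L] (m : Fin n) : L :=
  toL L (MvPolynomial.X (Sum.inl m) : MvPolynomial (Fin n ⊕ Fin r) K)

/-- The variable `s_i` in `K[x, s, 1/f]`. -/
def sL (_f : Fin r → MvPolynomial (Fin n) K) (L : Type*) [CommRing L]
    [Algebra (MvPolynomial (Fin n ⊕ Fin r) K) L] [Algebra K L]
    [IsScalarTower K (MvPolynomial (Fin n ⊕ Fin r) K) L] (i : Fin r) : L :=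
  toL L (MvPolynomial.X (Sum.inr i) : MvPolynomial (Fin n ⊕ Fin r) K)

variable (f : Fin r → MvPolynomial (Fin n) K) (L : Type*) [CommRing L]
  [Algebra (MvPolynomial (Fin n ⊕ Fin r) K) L] [Algebra K L]
  [IsScalarTower K (MvPolynomial (Fin n ⊕ Fin r) K) L] [IsLocalization (fPow f) L]

theorem isUnit_fL (j : Fin r) : IsUnit (toL L (fXS f j)) := by
  have h : IsUnit (toL L (∏ j, fXS f j)) :=
    IsLocalization.map_units L (⟨_, Submonoid.mem_powers _⟩ : fPow f)
  exact isUnit_of_dvd_unit (map_dvd _ (Finset.dvd_prod_of_mem _ (Finset.mem_univ j))) h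

/-- `f_j` as a unit of `K[x, s, 1/f]`. -/
def fL (j : Fin r) : Lˣ := (isUnit_fL f L j).unit

theorem fL_val (j : Fin r) : (fL f L j : L) = toL L (fXS f j) := rfl

/-- The substitution `G(x, s) ↦ G(x, s + v)` on `K[x, s]`. -/
def shiftP (v : Fin r → K) :
    MvPolynomial (Fin n ⊕ Fin r) K →ₐ[K] MvPolynomial (Fin n ⊕ Fin r) K :=
  MvPolynomial.aeval (Sum.elim (fun m => MvPolynomial.X (Sum.inl m))
    fun i => MvPolynomial.X (Sum.inr i) + MvPolynomial.C (v i))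

theorem shiftP_fXS (v : Fin r → K) (j : Fin r) : shiftP v (fXS f j) = fXS f j := by
  have h : (shiftP v).comp (MvPolynomial.rename Sum.inl) =
      (MvPolynomial.rename Sum.inl : MvPolynomial (Fin n) K →ₐ[K] _) :=
    MvPolynomial.algHom_ext fun m => by simp [shiftP]
  exact congrArg (fun φ => φ (f j)) h

theorem shift_isUnit (v : Fin r → K) (w : fPow f) :
    IsUnit (((toL L).comp (shiftP v) : MvPolynomial (Fin n ⊕ Fin r) K →ₐ[K] L) w) := by
  obtain ⟨w, k, rfl⟩ := w
  simp only [map_pow, map_prod, AlgHom.comp_apply, shiftP_fXS]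
  refine IsUnit.pow _ ?_
  rw [IsUnit.prod_univ_iff]
  exact fun j => isUnit_fL f L j

/-- The substitution `G(x, s) ↦ G(x, s + v)` on `K[x, s, 1/f]`. -/
def shiftL (v : Fin r → K) : L →ₐ[K] L :=
  IsLocalization.liftAlgHom (M := fPow f) (f := (toL L).comp (shiftP v)) (shift_isUnit f L v)

theorem shiftL_toL (v : Fin r → K) (p : MvPolynomial (Fin n ⊕ Fin r) K) :
    shiftL f L v (toL L p) = toL L (shiftP v p) :=
  IsLocalization.lift_eq _ _

theorem shiftL_xL (v : Fin r → K) (m : Fin n) :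
    shiftL f L v (xL f L m) = xL f L m := by
  rw [xL, shiftL_toL f L v]
  simp [shiftP]

theorem shiftL_sL (v : Fin r → K) (i : Fin r) :
    shiftL f L v (sL f L i) = sL f L i + algebraMap K L (v i) := by
  rw [sL, shiftL_toL, shiftP, MvPolynomial.aeval_X, Sum.elim_inr, map_add]
  congr 1
  exact (toL L).commutes (v i)

theorem shiftL_fL (v : Fin r → K) (j : Fin r) : shiftL f L v (fL f L j) = fL f L j := by
  rw [fL_val, shiftL_toL, shiftP_fXS]

theorem shiftL_inv (v : Fin r → K) (j : Fin r) :
    shiftL f L v ↑(fL f L j)⁻¹ = ↑(fL f L j)⁻¹ := by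
  rw [← (fL f L j).mul_right_inj]
  nth_rewrite 1 [← shiftL_fL f L v j]
  rw [← map_mul, Units.mul_inv, map_one]

theorem shiftL_shiftL (v w : Fin r → K) (G : L) :
    shiftL f L v (shiftL f L w G) = shiftL f L (v + w) G := by
  have : (shiftL f L v).comp (shiftL f L w) = shiftL f L (v + w) := by
    apply IsLocalization.algHom_ext (fPow f)
    apply MvPolynomial.algHom_ext
    rintro (m | i)
    · change shiftL f L v (shiftL f L w (xL f L m)) = shiftL f L (v + w) (xL f L m)
      simp only [shiftL_xL]
    · change shiftL f L v (shiftL f L w (sL f L i)) = shiftL f L (v + w) (sL f L i)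
      simp only [shiftL_sL, map_add, AlgHom.commutes, Pi.add_apply]
      ring
  exact congrArg (fun φ => φ G) this

/-- The partial derivative `∂/∂x_m` on `K[x, s, 1/f]`. -/
def pd (m : Fin n) : Derivation K L L := locDer (fPow f) L (MvPolynomial.pderiv (Sum.inl m))

theorem pd_toL (m : Fin n) (p : MvPolynomial (Fin n ⊕ Fin r) K) :
    pd f L m (toL L p) = toL L (MvPolynomial.pderiv (Sum.inl m) p) :=
  locDer_algebraMap _ _ _ _

/-- Derivations of `K[x, s, 1/f]` are determined by their values on the variables. -/
theorem der_ext {D E : Derivation K L L} (hx : ∀ m, D (xL f L m) = E (xL f L m))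
    (hs : ∀ i, D (sL f L i) = E (sL f L i)) : D = E := by
  have h0 : ∀ p : MvPolynomial (Fin n ⊕ Fin r) K, D (toL L p) = E (toL L p) := by
    have : (D.compAlgebraMap (MvPolynomial (Fin n ⊕ Fin r) K)) =
        (E.compAlgebraMap (MvPolynomial (Fin n ⊕ Fin r) K)) := by
      apply MvPolynomial.derivation_ext
      rintro (m | i)
      · exact hx m
      · exact hs i
    exact fun p => congrArg (fun D => D p) this
  ext a
  obtain ⟨⟨p, w⟩, h⟩ := IsLocalization.surj (fPow f) a
  have hw : IsUnit (toL L (w : MvPolynomial (Fin n ⊕ Fin r) K)) := IsLocalization.map_units L w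
  change a * toL L _ = toL L _ at h
  have e1 := congrArg D h
  have e2 := congrArg E h
  rw [Derivation.leibniz] at e1 e2
  rw [h0 p, ← e2, h0] at e1
  simp only [smul_eq_mul] at e1
  exact hw.mul_left_cancel (add_left_cancel e1)

theorem pd_xL (l m : Fin n) :
    pd f L l (xL f L m) = if l = m then 1 else 0 := by
  rw [xL, pd_toL, MvPolynomial.pderiv_X]
  by_cases h : l = m
  · subst h; simp
  · simp [h, Ne.symm h]

theorem pd_sL (m : Fin n) (i : Fin r) : pd f L m (sL f L i) = 0 := by
  rw [sL, pd_toL, MvPolynomial.pderiv_X]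
  simp

theorem pd_comm (l m : Fin n) (G : L) : pd f L l (pd f L m G) = pd f L m (pd f L l G) := by
  have : ⁅pd f L l, pd f L m⁆ = 0 := by
    apply der_ext f L
    · intro k
      rw [Derivation.commutator_apply]
      simp only [pd_xL, apply_ite, Derivation.map_one_eq_zero, map_zero, ite_self, sub_self]
      simp
    · intro k
      rw [Derivation.commutator_apply]
      simp [pd_sL]
  have h := congrArg (fun D => D G) this
  simp only [Derivation.commutator_apply] at h
  exact sub_eq_zero.mp h

theorem pd_shiftL (m : Fin n) (v : Fin r → K) (G : L) :
    pd f L m (shiftL f L v G) = shiftL f L v (pd f L m G) := by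
  -- conjugate `∂/∂x_m` by the shift
  have hinv : ∀ G, shiftL f L v (shiftL f L (-v) G) = G := by
    intro G
    rw [shiftL_shiftL, add_neg_cancel]
    have : shiftL f L 0 = AlgHom.id K L := by
      apply IsLocalization.algHom_ext (fPow f)
      apply MvPolynomial.algHom_ext
      rintro (m | i)
      · exact shiftL_xL f L 0 m
      · exact (shiftL_sL f L 0 i).trans (by simp; rfl)
    rw [this]; rfl
  have hinv' : ∀ G, shiftL f L (-v) (shiftL f L v G) = G := by
    intro G
    have := hinv G
    rw [shiftL_shiftL, add_comm, ← shiftL_shiftL] at this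
    exact this
  let D : Derivation K L L := Derivation.mk'
    ((shiftL f L v).toLinearMap ∘ₗ (pd f L m : L →ₗ[K] L) ∘ₗ (shiftL f L (-v)).toLinearMap)
    (fun a b => by simp [hinv])
  have hD : D = pd f L m := by
    apply der_ext f L
    · intro k
      change shiftL f L v (pd f L m (shiftL f L (-v) _)) = _
      rw [shiftL_xL, pd_xL]
      split_ifs <;> simp
    · intro k
      change shiftL f L v (pd f L m (shiftL f L (-v) _)) = _
      rw [shiftL_sL, map_add, pd_sL, Derivation.map_algebraMap]
      simp
  have h2 : D (shiftL f L v G) = shiftL f L v (pd f L m G) := by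
    change shiftL f L v (pd f L m (shiftL f L (-v) _)) = _
    rw [hinv']
  rw [← h2, hD]

/-- The logarithmic derivative `∑_j s_j (∂f_j/∂x_m) / f_j` of `f^s = f_1^{s_1} ⋯ f_r^{s_r}`. -/
def logDer (m : Fin n) : L :=
  ∑ j : Fin r, sL f L j * pd f L m (fL f L j) * ↑(fL f L j)⁻¹

theorem pd_inv (m : Fin n) (j : Fin r) :
    pd f L m ↑(fL f L j)⁻¹ = - (↑(fL f L j)⁻¹ * ↑(fL f L j)⁻¹ * pd f L m (fL f L j)) := by
  have h : pd f L m ((fL f L j : L) * ↑(fL f L j)⁻¹) = 0 := by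
    rw [Units.mul_inv, Derivation.map_one_eq_zero]
  rw [Derivation.leibniz, smul_eq_mul, smul_eq_mul] at h
  have h1 : (↑(fL f L j)⁻¹ : L) * fL f L j = 1 := Units.inv_mul _
  linear_combination (↑(fL f L j)⁻¹ : L) * h - (pd f L m ↑(fL f L j)⁻¹) * h1

theorem pd_logDer (l m : Fin n) : pd f L l (logDer f L m) = pd f L m (logDer f L l) := by
  simp only [logDer, map_sum]
  refine Finset.sum_congr rfl fun j _ => ?_
  simp only [Derivation.leibniz, pd_sL, pd_inv, smul_eq_mul]
  rw [pd_comm f L m l]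
  ring

theorem shiftL_logDer (v : Fin r → K) (m : Fin n) :
    shiftL f L v (logDer f L m) = logDer f L m +
      ∑ j : Fin r, algebraMap K L (v j) * pd f L m (fL f L j) * ↑(fL f L j)⁻¹ := by
  simp only [logDer, map_sum, map_mul, shiftL_sL, shiftL_inv, ← pd_shiftL, shiftL_fL,
    add_mul, Finset.sum_add_distrib]

/-! An element `G · f^s` of the free module `M` of rank one is represented by its coordinate
`G ∈ L = K[x, s, 1/f]`. -/

/-- The action of `x_m` on `M`: `x_m • (G · f^s) = (x_m G) · f^s`. -/
def actX (m : Fin n) : Module.End K L := LinearMap.mulLeft K (xL f L m)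

/-- The action of `∂_m` on `M`:
`∂_m • (G · f^s) = (∂G/∂x_m + G ∑_j s_j (∂f_j/∂x_m) / f_j) · f^s`. -/
def actD (m : Fin n) : Module.End K L :=
  (pd f L m : L →ₗ[K] L) + LinearMap.mulLeft K (logDer f L m)

/-- The action of `s_ij` on `M`:
`s_ij • (G(s) · f^s) = s_i G(s + ε_j - ε_i) (f_j / f_i) · f^s`. -/
def actS (i j : Fin r) : Module.End K L :=
  LinearMap.mulLeft K (sL f L i * fL f L j * ↑(fL f L i)⁻¹) ∘ₗ
    (shiftL f L (Pi.single j 1 - Pi.single i 1)).toLinearMap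

theorem actX_apply (m : Fin n) (G : L) : actX f L m G = xL f L m * G := rfl

theorem actD_apply (m : Fin n) (G : L) : actD f L m G = pd f L m G + logDer f L m * G := rfl

theorem actS_apply (i j : Fin r) (G : L) : actS f L i j G =
    sL f L i * fL f L j * ↑(fL f L i)⁻¹ *
      shiftL f L (Pi.single j 1 - Pi.single i 1) G := rfl

/-- The action of `D_n⟨S⟩` on `M`. -/
def action : DnS K n r →ₐ[K] Module.End K L :=
  dnsLift (actX f L) (actD f L)
    (by
      intro i j
      ext G
      simp only [Module.End.mul_apply, actX_apply]
      ring)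
    (by
      intro i j
      ext G
      simp only [Module.End.mul_apply, actD_apply, map_add, Derivation.leibniz, smul_eq_mul]
      rw [pd_comm f L i j, pd_logDer f L i j]
      ring)
    (by
      intro i j
      ext G
      have : (if i = j then (1 : Module.End K L) else 0) G = (if i = j then (1 : L) else 0) * G := by
        split_ifs <;> simp
      simp only [Module.End.mul_apply, LinearMap.add_apply, actD_apply, actX_apply,
        Derivation.leibniz, smul_eq_mul, this, pd_xL]
      ring)
    (actS f L)
    (by
      intro i j k l
      ext G
      set T := shiftL f L (Pi.single j 1 - Pi.single i 1 + (Pi.single l 1 - Pi.single k 1)) G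
        with hT
      set c : L := fL f L j * ↑(fL f L i)⁻¹ * (fL f L l * ↑(fL f L k)⁻¹) * T with hc
      have e1 : (if j = k then actS f L i l else 0) G =
          (if j = k then 1 else 0) * (sL f L i * c) := by
        split_ifs with h
        · subst h
          rw [actS_apply, hc, hT, show (Pi.single j 1 - Pi.single i 1 +
            (Pi.single l 1 - Pi.single j 1) : Fin r → K) = Pi.single l 1 - Pi.single i 1 by abel]
          linear_combination (- sL f L i * fL f L l * ↑(fL f L i)⁻¹ *
            shiftL f L (Pi.single l 1 - Pi.single i 1) G) * (fL f L j).mul_inv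
        · simp
      have e2 : (if i = l then actS f L k j else 0) G =
          (if i = l then 1 else 0) * (sL f L k * c) := by
        split_ifs with h
        · subst h
          rw [actS_apply, hc, hT, show (Pi.single j 1 - Pi.single i 1 +
            (Pi.single i 1 - Pi.single k 1) : Fin r → K) = Pi.single j 1 - Pi.single k 1 by abel]
          linear_combination (- sL f L k * fL f L j * ↑(fL f L k)⁻¹ *
            shiftL f L (Pi.single j 1 - Pi.single k 1) G) * (fL f L i).mul_inv
        · simp
      have e3 : (if i = k then 1 else 0) * sL f L i = (if i = k then 1 else 0) * sL f L k := by
        split_ifs with h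
        · rw [h]
        · simp
      have d1 : algebraMap K L ((Pi.single j 1 - Pi.single i 1 : Fin r → K) k) =
          (if j = k then 1 else 0) - (if i = k then 1 else 0) := by
        simp [Pi.single_apply, apply_ite (algebraMap K L), eq_comm]
      have d2 : algebraMap K L ((Pi.single l 1 - Pi.single k 1 : Fin r → K) i) =
          (if i = l then 1 else 0) - (if i = k then 1 else 0) := by
        simp [Pi.single_apply, apply_ite (algebraMap K L)]
      rw [LinearMap.sub_apply, LinearMap.sub_apply, e1, e2]
      simp only [Module.End.mul_apply, actS_apply, map_mul, shiftL_sL, shiftL_fL, shiftL_inv,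
        shiftL_shiftL, d1, d2]
      rw [add_comm (Pi.single l 1 - Pi.single k 1 : Fin r → K), ← hT, hc]
      linear_combination (- (fL f L j * ↑(fL f L i)⁻¹ * (fL f L l * ↑(fL f L k)⁻¹) * T)) * e3)
    (by
      intro m i j
      ext G
      simp only [Module.End.mul_apply, actS_apply, actX_apply, map_mul, shiftL_xL]
      ring)
    (by
      intro m i j
      ext G
      have e : ∑ k : Fin r, algebraMap K L ((Pi.single j 1 - Pi.single i 1 : Fin r → K) k) *
          pd f L m (fL f L k) * ↑(fL f L k)⁻¹ =
          pd f L m (fL f L j) * ↑(fL f L j)⁻¹ - pd f L m (fL f L i) * ↑(fL f L i)⁻¹ := by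
        simp [sub_mul, Finset.sum_sub_distrib, Pi.single_apply, apply_ite (algebraMap K L)]
      simp only [Module.End.mul_apply, actS_apply, actD_apply, map_add, map_mul, shiftL_logDer,
        Derivation.leibniz, pd_sL, pd_inv, pd_shiftL, smul_eq_mul, e]
      linear_combination (- sL f L i * ↑(fL f L i)⁻¹ * pd f L m (fL f L j) *
        shiftL f L (Pi.single j 1 - Pi.single i 1) G) * (fL f L j).mul_inv)

/-- The annihilator of `f^s` in `D_n⟨S⟩`, the left ideal of all `P` with `P • f^s = 0`, where
`M = K[x, s, 1/f] · f^s`; the element `f^s` has coordinate `1`. -/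
def annFs : Ideal (DnS K n r) where
  carrier := {P | action f (Localization (fPow f)) P 1 = 0}
  zero_mem' := by simp
  add_mem' {P Q} hP hQ := by
    simp only [Set.mem_ofPred_eq] at hP hQ ⊢
    rw [map_add, LinearMap.add_apply, hP, hQ, add_zero]
  smul_mem' P Q hQ := by
    simp only [Set.mem_ofPred_eq] at hQ ⊢
    rw [smul_eq_mul, map_mul, Module.End.mul_apply, hQ, map_zero]

end Module

end BMVar

end

noncomputable section

namespace BMVar

/-! ### Normal forms modulo `bmIdeal` -/

section NormalForm

variable {K : Type*} [Field K] {n r : ℕ}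

/-! The action on $M$ extends to $D_n\langle\partial t,S\rangle$. Formally $s_{ij}$ should act as
$-\partial t_i\,t_j$, where $t_j$ is $G(s)\mapsto G(s+\epsilon_j)f_j$; this dictates $\partial
t_k\bullet(G(s)f^s)=-s_kG(s-\epsilon_k)f_k^{-1}f^s$, and the defining relations hold
(`exists_extended_action`). The listed generators kill $f^s$, so `bmIdeal` lies in the annihilator
of $f^s$ in the larger algebra (`extAction_one_eq_zero`).

For the converse, the generators of the ideal rewrite $s_{ij}$ as $-\partial t_i f_j$ and
$\partial_m$ as $-\sum_k(\partial f_k/\partial x_m)\partial t_k$. Hence every operator is congruent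
modulo `bmIdeal` to a polynomial in the commuting elements $\partial t_k$, $x_m$
(`exists_sub_symbolHom_mem`). Such a polynomial kills $f^s$ only if it is zero
(`eq_zero_of_extAction_symbolHom`): $\partial t^\alpha\bullet f^s$ has coordinate
$\prod_i(-1)^{\alpha_i}s_i(s_i-1)\cdots(s_i-\alpha_i+1)f_i^{-\alpha_i}$, and falling factorials are
linearly independent in characteristic zero, as evaluation at $s=\beta\in\mathbb{N}^r$ is
triangular.

So the annihilator in $D_n\langle\partial t,S\rangle$ is exactly `bmIdeal`
(`extAction_one_eq_zero_iff`), and restriction to $D_n\langle S\rangle$ gives the theorem. -/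

theorem gen_dt_dt (k l : Fin r) :
    gen K (.dt k : Gen n r) * gen K (.dt l) = gen K (.dt l) * gen K (.dt k) := by
  simpa [gen] using RingQuot.mkAlgHom_rel K (s := Rel K n r) (RelOn.dt_dt k l)

theorem gen_dt_x (k : Fin r) (m : Fin n) :
    gen K (.dt k : Gen n r) * gen K (.x m) = gen K (.x m) * gen K (.dt k) := by
  simpa [gen] using RingQuot.mkAlgHom_rel K (s := Rel K n r) (RelOn.dt_x k m)

theorem gen_dt_d (k : Fin r) (m : Fin n) :
    gen K (.dt k : Gen n r) * gen K (.d m) = gen K (.d m) * gen K (.dt k) := by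
  simpa [gen] using RingQuot.mkAlgHom_rel K (s := Rel K n r) (RelOn.dt_d k m)

theorem gen_s_dt (i j k : Fin r) :
    gen K (.s i j : Gen n r) * gen K (.dt k) - gen K (.dt k) * gen K (.s i j) =
      if j = k then gen K (.dt i) else 0 := by
  have := RingQuot.mkAlgHom_rel K (s := Rel K n r) (RelOn.s_dt i j k)
  split_ifs at this ⊢ <;> simpa [gen] using this

/-- The pairwise commuting generators `∂t_k` and `x_m` of `D_n⟨∂t, S⟩`. -/
def commGen : Fin r ⊕ Fin n → DntS K n r :=
  Sum.elim (fun k => gen K (.dt k)) (fun m => gen K (.x m))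

theorem commGen_comm (a b : Fin r ⊕ Fin n) :
    commGen (K := K) a * commGen b = commGen b * commGen a := by
  rcases a with k | m <;> rcases b with l | p
  · exact gen_dt_dt k l
  · exact gen_dt_x k p
  · exact (gen_dt_x l m).symm
  · exact gen_x_x K m p

variable (K n r) in
/-- The homomorphism `K[y, x] → D_n⟨∂t, S⟩` with `y_k ↦ ∂t_k` and `x_m ↦ x_m`. -/
def symbolHom : MvPolynomial (Fin r ⊕ Fin n) K →ₐ[K] DntS K n r :=
  -- `MvPolynomial.aeval` needs a commutative target, so the map is built into the subalgebra
  -- generated by the pairwise commuting elements and then included.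
  letI : CommRing (Algebra.adjoin K (Set.range (commGen (K := K) (n := n) (r := r)))) :=
    { (Algebra.adjoin K (Set.range (commGen (K := K) (n := n) (r := r)))).toRing with
      mul_comm := (Algebra.isMulCommutative_adjoin K
        (by rintro _ ⟨i, rfl⟩ _ ⟨j, rfl⟩; exact commGen_comm i j)).is_comm.comm }
  (Algebra.adjoin K (Set.range (commGen (K := K) (n := n) (r := r)))).val.comp
    (MvPolynomial.aeval fun a => ⟨commGen a, Algebra.subset_adjoin ⟨a, rfl⟩⟩)

theorem symbolHom_inl (k : Fin r) :
    symbolHom K n r (MvPolynomial.X (Sum.inl k)) = gen K (.dt k) := by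
  simp [symbolHom]
  rfl

theorem symbolHom_inr (m : Fin n) :
    symbolHom K n r (MvPolynomial.X (Sum.inr m)) = gen K (.x m) := by
  simp [symbolHom]
  rfl

theorem symbolHom_rename (p : MvPolynomial (Fin n) K) :
    symbolHom K n r (MvPolynomial.rename Sum.inr p) = polyHom K p := by
  have : (symbolHom K n r).comp (MvPolynomial.rename Sum.inr) = polyHom K :=
    MvPolynomial.algHom_ext fun m => by
      simp [symbolHom_inr, polyHom_X]
  exact congrArg (fun φ => φ p) this

/-- The commutator with $\partial_m$ is a derivation that kills every $\partial t_k$ and sends $x_l$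
to $\delta_{ml}$, so on symbols it is $\partial/\partial x_m$. This moves $\partial_m$ to the right,
where a generator of the left ideal can absorb it. -/
theorem d_mul_symbolHom (m : Fin n) (p : MvPolynomial (Fin r ⊕ Fin n) K) :
    gen K (.d m) * symbolHom K n r p = symbolHom K n r p * gen K (.d m) +
      symbolHom K n r (MvPolynomial.pderiv (Sum.inr m) p) := by
  induction p using MvPolynomial.induction_on with
  | C a => simp [Algebra.commutes]
  | add p q hp hq => simp only [map_add, mul_add, add_mul, hp, hq]; abel
  | mul_X p a hp =>
    rw [map_mul, ← mul_assoc, hp, Derivation.leibniz, smul_eq_mul, smul_eq_mul,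
      MvPolynomial.pderiv_X, map_add, map_mul, map_mul]
    rcases a with k | l
    · rw [Pi.single_eq_of_ne (by simp), map_zero, mul_zero, zero_add, symbolHom_inl, add_mul,
        mul_assoc, ← gen_dt_d, mul_assoc, ← symbolHom_inl, ← map_mul, ← map_mul,
        mul_comm (MvPolynomial.X _)]
    · rw [symbolHom_inr, add_mul, mul_assoc, gen_d_x, mul_add, mul_assoc, add_assoc,
        ← symbolHom_inr, ← map_mul, ← map_mul _ (MvPolynomial.X _),
        mul_comm _ (MvPolynomial.X _)]
      by_cases h : m = l
      · subst h; simp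
      · simp [h, Ne.symm h]

/-- The commutator with $s_{ij}$ is a derivation that kills every $x_m$ and sends $\partial t_k$ to
$\delta_{jk}\partial t_i$, so on symbols it is the vector field $y_i\,\partial/\partial y_j$. -/
theorem s_mul_symbolHom (i j : Fin r) (p : MvPolynomial (Fin r ⊕ Fin n) K) :
    gen K (.s i j) * symbolHom K n r p = symbolHom K n r p * gen K (.s i j) +
      symbolHom K n r (MvPolynomial.X (Sum.inl i) * MvPolynomial.pderiv (Sum.inl j) p) := by
  induction p using MvPolynomial.induction_on with
  | C a => simp [Algebra.commutes]
  | add p q hp hq => simp only [map_add, mul_add, add_mul, hp, hq]; abel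
  | mul_X p a hp =>
    rw [map_mul, ← mul_assoc, hp, Derivation.leibniz, smul_eq_mul, smul_eq_mul,
      MvPolynomial.pderiv_X, add_mul, mul_assoc, mul_assoc, ← map_mul _ (_ * _),
      mul_add, map_add, ← add_assoc,
      show MvPolynomial.X (Sum.inl i) * (MvPolynomial.X a * MvPolynomial.pderiv (Sum.inl j) p) =
        MvPolynomial.X (Sum.inl i) * MvPolynomial.pderiv (Sum.inl j) p * MvPolynomial.X a by ring]
    congr 1
    rw [mul_left_comm, map_mul _ p, ← mul_add]
    congr 1
    rcases a with k | l
    · rw [symbolHom_inl, ← sub_eq_iff_eq_add', gen_s_dt]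
      by_cases h : j = k
      · subst h; simp [symbolHom_inl]
      · simp [h, Ne.symm h]
    · rw [symbolHom_inr, ← gen_x_s]
      simp

/-- Every element of `D_n⟨∂t, S⟩` is congruent modulo `bmIdeal` to a polynomial in the `∂t_k`
and `x_m`. -/
theorem exists_sub_symbolHom_mem (f : Fin r → MvPolynomial (Fin n) K) (P : DntS K n r) :
    ∃ p, P - symbolHom K n r p ∈ bmIdeal f := by
  -- Strengthened to products with an arbitrary symbol, the claim is stable under products in `P`:
  -- since `bmIdeal` is a left ideal, $bp\equiv q$ implies $abp\equiv aq$. Only the generators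
  -- remain to be checked.
  suffices h : ∀ P : DntS K n r, ∀ p, ∃ q, P * symbolHom K n r p - symbolHom K n r q ∈ bmIdeal f by
    simpa using h P 1
  intro P
  obtain ⟨a, rfl⟩ := RingQuot.mkAlgHom_surjective K (Rel K n r) P
  induction a using FreeAlgebra.induction with
  | grade0 c =>
    refine fun p => ⟨c • p, ?_⟩
    rw [AlgHom.commutes, ← Algebra.smul_def, map_smul, sub_self]
    exact zero_mem _
  | add a b ha hb =>
    intro p
    obtain ⟨q, hq⟩ := ha p
    obtain ⟨q', hq'⟩ := hb p
    refine ⟨q + q', ?_⟩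
    rw [map_add, map_add, add_mul, add_sub_add_comm]
    exact add_mem hq hq'
  | mul a b ha hb =>
    intro p
    obtain ⟨q, hq⟩ := hb p
    obtain ⟨q', hq'⟩ := ha q
    refine ⟨q', ?_⟩
    have := add_mem ((bmIdeal f).mul_mem_left (RingQuot.mkAlgHom K (Rel K n r) a) hq) hq'
    rwa [mul_sub, sub_add_sub_cancel, ← mul_assoc, ← map_mul] at this
  | grade1 g =>
    intro p
    change ∃ q, gen K g * _ - _ ∈ _
    cases g with
    | x m =>
      refine ⟨MvPolynomial.X (Sum.inr m) * p, ?_⟩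
      rw [map_mul, symbolHom_inr, sub_self]
      exact zero_mem _
    | dt k =>
      refine ⟨MvPolynomial.X (Sum.inl k) * p, ?_⟩
      rw [map_mul, symbolHom_inl, sub_self]
      exact zero_mem _
    | d m =>
      -- In $\partial_m p=p\,\partial_m+\partial p/\partial x_m$ the final $\partial_m$ is replaced
      -- by $-\sum_k(\partial f_k/\partial x_m)\partial t_k$.
      refine ⟨MvPolynomial.pderiv (Sum.inr m) p - p * ∑ k : Fin r, MvPolynomial.rename Sum.inr
        (MvPolynomial.pderiv m (f k)) * MvPolynomial.X (Sum.inl k), ?_⟩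
      have := (bmIdeal f).mul_mem_left (symbolHom K n r p)
        (Ideal.subset_span (Or.inr ⟨m, rfl⟩))
      rw [d_mul_symbolHom]
      simp only [map_sub, map_mul, map_sum, symbolHom_rename, symbolHom_inl]
      rw [mul_add] at this
      convert this using 1
      abel
    | s i j =>
      -- In $s_{ij}p=p\,s_{ij}+y_i\,\partial p/\partial y_j$ the final $s_{ij}$ is replaced by
      -- $-\partial t_i f_j$.
      refine ⟨MvPolynomial.X (Sum.inl i) * MvPolynomial.pderiv (Sum.inl j) p -
        p * (MvPolynomial.X (Sum.inl i) * MvPolynomial.rename Sum.inr (f j)), ?_⟩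
      have := (bmIdeal f).mul_mem_left (symbolHom K n r p)
        (Ideal.subset_span (Or.inl ⟨(i, j), rfl⟩))
      rw [s_mul_symbolHom]
      simp only [map_sub, map_mul _ p, map_mul _ (MvPolynomial.X _) (MvPolynomial.rename _ _),
        symbolHom_rename, symbolHom_inl]
      rw [mul_add] at this
      convert this using 1
      abel

end NormalForm

/-! ### The action of `D_n⟨∂t, S⟩` on `M` -/

section Action

variable {K : Type*} [Field K] {n r : ℕ}

/-- The generator `x_m` of `D_n⟨S⟩`. -/
def DnS.x (r : ℕ) (m : Fin n) : DnS K n r :=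
  RingQuot.mkAlgHom K (WeylRel K n) (FreeAlgebra.ι K (.x m)) ⊗ₜ 1

/-- The generator `∂_m` of `D_n⟨S⟩`. -/
def DnS.d (r : ℕ) (m : Fin n) : DnS K n r :=
  RingQuot.mkAlgHom K (WeylRel K n) (FreeAlgebra.ι K (.d m)) ⊗ₜ 1

/-- The generator `s_ij` of `D_n⟨S⟩`. -/
def DnS.s (n : ℕ) (i j : Fin r) : DnS K n r := 1 ⊗ₜ UGl.s K i j

/-- Two algebra homomorphisms out of `D_n⟨S⟩` that agree on the generators are equal. -/
theorem DnS.hom_ext {C : Type*} [Ring C] [Algebra K C] {φ ψ : DnS K n r →ₐ[K] C}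
    (hx : ∀ m, φ (DnS.x r m) = ψ (DnS.x r m)) (hd : ∀ m, φ (DnS.d r m) = ψ (DnS.d r m))
    (hs : ∀ i j, φ (DnS.s n i j) = ψ (DnS.s n i j)) : φ = ψ := by
  apply Algebra.TensorProduct.ext
  · apply RingQuot.ringQuot_ext'
    apply FreeAlgebra.hom_ext
    funext g
    cases g with
    | x m => exact hx m
    | d m => exact hd m
  · exact gl_hom_ext (φ := (φ.restrictScalars K).comp Algebra.TensorProduct.includeRight)
      (ψ := (ψ.restrictScalars K).comp Algebra.TensorProduct.includeRight) hs

/-- A homomorphism out of `D_n⟨S⟩` extends to `D_n⟨∂t, S⟩`, given images `T k` of the `∂t_k` that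
satisfy the relations. -/
theorem DnS.exists_extension {C : Type*} [Ring C] [Algebra K C] (φ : DnS K n r →ₐ[K] C)
    (T : Fin r → C)
    (hTT : ∀ k l, T k * T l = T l * T k)
    (hTX : ∀ k m, T k * φ (DnS.x r m) = φ (DnS.x r m) * T k)
    (hTD : ∀ k m, T k * φ (DnS.d r m) = φ (DnS.d r m) * T k)
    (hσT : ∀ i j k, φ (DnS.s n i j) * T k - T k * φ (DnS.s n i j) = if j = k then T i else 0) :
    ∃ ψ : DntS K n r →ₐ[K] C, ψ.comp (incl K n r) = φ ∧ ∀ k, ψ (gen K (.dt k)) = T k := by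
  have hcomm (w : Weyl K n) (u : UGl K r) :
      φ (w ⊗ₜ 1) * φ (1 ⊗ₜ u) = φ (1 ⊗ₜ u) * φ (w ⊗ₜ 1) := by
    rw [← map_mul, ← map_mul, Algebra.TensorProduct.tmul_mul_tmul,
      Algebra.TensorProduct.tmul_mul_tmul, one_mul, mul_one, one_mul, mul_one]
  let φW : Weyl K n →ₐ[K] C := φ.comp Algebra.TensorProduct.includeLeft
  let φU : UGl K r →ₐ[K] C := φ.comp Algebra.TensorProduct.includeRight
  let ψ : DntS K n r →ₐ[K] C := dntsLift (fun m => φ (DnS.x r m)) (fun m => φ (DnS.d r m)) T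
    (fun i j => φ (DnS.s n i j))
    (fun i j => by
      have := congrArg φW (RingQuot.mkAlgHom_rel K (s := WeylRel K n) (WeylRelOn.x_x i j))
      simp only [map_mul] at this
      exact this)
    (fun i j => by
      have := congrArg φW (RingQuot.mkAlgHom_rel K (s := WeylRel K n) (WeylRelOn.d_d i j))
      simp only [map_mul] at this
      exact this)
    (fun i j => by
      have := congrArg φW (RingQuot.mkAlgHom_rel K (s := WeylRel K n) (WeylRelOn.d_x i j))
      split_ifs at this ⊢ <;> simp only [map_mul, map_add, map_one, map_zero] at this <;>
        exact this)
    hTT hTX hTD (fun m i j => hcomm _ _) (fun m i j => hcomm _ _) hσT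
    (fun i j k l => by
      have := congrArg φU (UGl.s_s (K := K) i j k l)
      rwa [map_sub, map_mul, map_mul, map_sub, apply_ite φU, apply_ite φU, map_zero] at this)
  have hψ (g : Gen n r) : ψ (gen K g) = _ :=
    (RingQuot.liftAlgHom_mkAlgHom_apply _ _ _ _).trans (FreeAlgebra.lift_ι_apply _ _)
  refine ⟨ψ, DnS.hom_ext (fun m => ?_) (fun m => ?_) (fun i j => ?_), fun k => hψ _⟩
  · rw [AlgHom.comp_apply, DnS.x, incl_x, hψ]; rfl
  · rw [AlgHom.comp_apply, DnS.d, incl_d, hψ]; rfl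
  · rw [AlgHom.comp_apply, DnS.s, incl_s, hψ]; rfl

variable (f : Fin r → MvPolynomial (Fin n) K) (L : Type*) [CommRing L]
  [Algebra (MvPolynomial (Fin n ⊕ Fin r) K) L] [Algebra K L]
  [IsScalarTower K (MvPolynomial (Fin n ⊕ Fin r) K) L] [IsLocalization (fPow f) L]

theorem action_x (m : Fin n) : action f L (DnS.x r m) = actX f L m := by
  simp [action, dnsLift, weylLift, DnS.x]

theorem action_d (m : Fin n) : action f L (DnS.d r m) = actD f L m := by
  simp [action, dnsLift, weylLift, DnS.d]

theorem action_s (i j : Fin r) : action f L (DnS.s n i j) = actS f L i j := by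
  rw [action, dnsLift, DnS.s, Algebra.TensorProduct.lift_tmul, map_one, one_mul, glLift_s]

/-- The action of `∂t_k` on `M`: `∂t_k • (G(s) · f^s) = -s_k G(s - ε_k) f_k⁻¹ · f^s`. -/
def actT (k : Fin r) : Module.End K L :=
  LinearMap.mulLeft K (-(sL f L k * ↑(fL f L k)⁻¹)) ∘ₗ
    (shiftL f L (-Pi.single k 1)).toLinearMap

theorem actT_apply (k : Fin r) (G : L) : actT f L k G =
    -(sL f L k * ↑(fL f L k)⁻¹) * shiftL f L (-Pi.single k 1) G := rfl

/-- The action of `D_n⟨S⟩` on `M` extends to `D_n⟨∂t, S⟩`. -/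
theorem exists_extended_action : ∃ ψ : DntS K n r →ₐ[K] Module.End K L,
    ψ.comp (incl K n r) = action f L ∧ ∀ k, ψ (gen K (.dt k)) = actT f L k := by
  refine DnS.exists_extension _ _ ?_ ?_ ?_ ?_
  · intro k l
    ext G
    have d : ∀ a b : Fin r, algebraMap K L ((-Pi.single a 1 : Fin r → K) b) =
        - if a = b then 1 else 0 := by
      intro a b
      simp [Pi.single_apply, apply_ite (algebraMap K L), eq_comm]
    simp only [Module.End.mul_apply, actT_apply, map_mul, map_neg, shiftL_sL, shiftL_inv,
      shiftL_shiftL, d]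
    rw [add_comm (-Pi.single k 1 : Fin r → K)]
    -- For $k\ne l$ the shift by $-\epsilon_k$ fixes $s_l$, so the prefactors do not interact.
    by_cases h : k = l
    · subst h; rfl
    · rw [if_neg h, if_neg (Ne.symm h)]
      ring
  · intro k m
    ext G
    simp only [action_x, Module.End.mul_apply, actT_apply, actX_apply, map_mul, shiftL_xL]
    ring
  · intro k m
    ext G
    -- The change of the logarithmic derivative under $s\mapsto s-\epsilon_k$; it matches the term
    -- that $\partial_m$ produces from the factor $f_k^{-1}$ in `actT`.
    have e : ∑ j : Fin r, algebraMap K L ((-Pi.single k 1 : Fin r → K) j) *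
        pd f L m (fL f L j) * ↑(fL f L j)⁻¹ = - (pd f L m (fL f L k) * ↑(fL f L k)⁻¹) := by
      simp [Pi.single_apply, apply_ite (algebraMap K L)]
    simp only [action_d, Module.End.mul_apply, actT_apply, actD_apply, map_add, map_mul, map_neg,
      shiftL_logDer, Derivation.leibniz, pd_sL, pd_inv, pd_shiftL, smul_eq_mul, e]
    ring
  · intro i j k
    ext G
    have d1 : ∀ a b : Fin r, algebraMap K L ((-Pi.single a 1 : Fin r → K) b) =
        - if a = b then 1 else 0 := by
      intro a b
      simp [Pi.single_apply, apply_ite (algebraMap K L), eq_comm]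
    have d2 : algebraMap K L ((Pi.single j 1 - Pi.single i 1 : Fin r → K) k) =
        (if j = k then 1 else 0) - (if i = k then 1 else 0) := by
      simp [Pi.single_apply, apply_ite (algebraMap K L), eq_comm]
    rw [action_s]
    simp only [LinearMap.sub_apply, Module.End.mul_apply, actS_apply, actT_apply, map_mul, map_neg,
      shiftL_sL, shiftL_fL, shiftL_inv, shiftL_shiftL, d1, d2]
    rw [add_comm (-Pi.single k 1 : Fin r → K)]
    -- Both orders carry the same shift. The prefactors differ by
    -- $-\frac{f_j}{f_if_k}\bigl(s_i(s_k+\delta_{jk}-\delta_{ik})-s_k(s_i-\delta_{ik})\bigr)$; the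
    -- $\delta_{ik}$ terms cancel, leaving $-\delta_{jk}s_i/f_i$, the prefactor of
    -- $\delta_{jk}\partial t_i$.
    by_cases hj : j = k
    · subst hj
      have e : (Pi.single j 1 - Pi.single i 1 + -Pi.single j 1 : Fin r → K) = -Pi.single i 1 := by
        abel
      rw [e, if_pos rfl, if_pos rfl, actT_apply]
      have h1 := (fL f L j).mul_inv
      by_cases hi : i = j
      · subst hi
        simp only [if_true]
        linear_combination (-(sL f L i * ↑(fL f L i)⁻¹ * shiftL f L (-Pi.single i 1) G)) * h1
      · simp only [if_neg hi, if_neg (Ne.symm hi)]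
        linear_combination (-(sL f L i * ↑(fL f L i)⁻¹ * shiftL f L (-Pi.single i 1) G)) * h1
    · rw [if_neg hj, if_neg hj, LinearMap.zero_apply]
      by_cases hi : i = k
      · subst hi
        simp only [if_true]
        ring
      · simp only [if_neg hi, if_neg (Ne.symm hi)]
        ring

/-- An action of `D_n⟨∂t, S⟩` on `M` as in `exists_extended_action`. -/
def extAction : DntS K n r →ₐ[K] Module.End K L := (exists_extended_action f L).choose

theorem extAction_incl (P : DnS K n r) : extAction f L (incl K n r P) = action f L P :=
  congrArg (fun φ => φ P) (exists_extended_action f L).choose_spec.1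

theorem extAction_dt (k : Fin r) : extAction f L (gen K (.dt k)) = actT f L k :=
  (exists_extended_action f L).choose_spec.2 k

theorem extAction_x (m : Fin n) : extAction f L (gen K (.x m)) = actX f L m := by
  rw [← incl_x, extAction_incl, ← action_x]; rfl

theorem extAction_d (m : Fin n) : extAction f L (gen K (.d m)) = actD f L m := by
  rw [← incl_d, extAction_incl, ← action_d]; rfl

theorem extAction_s (i j : Fin r) : extAction f L (gen K (.s i j)) = actS f L i j := by
  rw [← incl_s, extAction_incl, ← action_s]; rfl

theorem extAction_polyHom (p : MvPolynomial (Fin n) K) :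
    extAction f L (polyHom K p) = LinearMap.mulLeft K (toL (n := n) (r := r) L (MvPolynomial.rename Sum.inl p)) := by
  have : (extAction f L).comp (polyHom K) =
      (Algebra.lmul K L).comp ((toL (n := n) (r := r) L).comp (MvPolynomial.rename Sum.inl)) :=
    MvPolynomial.algHom_ext fun m => by
      rw [AlgHom.comp_apply, polyHom_X, extAction_x, AlgHom.comp_apply, AlgHom.comp_apply,
        MvPolynomial.rename_X]
      rfl
  exact congrArg (fun φ => φ p) this

theorem toL_pderiv (m : Fin n) (k : Fin r) :
    toL (n := n) (r := r) L (MvPolynomial.rename Sum.inl (MvPolynomial.pderiv m (f k))) =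
      pd f L m (fL f L k) := by
  rw [fL_val, pd_toL, fXS, MvPolynomial.pderiv_rename Sum.inl_injective]

/-- `bmIdeal` annihilates `f^s`. -/
theorem extAction_one_eq_zero {P : DntS K n r} (hP : P ∈ bmIdeal f) : extAction f L P 1 = 0 := by
  induction hP using Submodule.span_induction with
  | zero => simp
  | add P Q _ _ hP hQ => rw [map_add, LinearMap.add_apply, hP, hQ, add_zero]
  | smul P Q _ hQ => rw [smul_eq_mul, map_mul, Module.End.mul_apply, hQ, map_zero]
  | mem P hP =>
    rcases hP with ⟨⟨i, j⟩, rfl⟩ | ⟨m, rfl⟩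
    · simp only [map_add, map_mul, extAction_s, extAction_dt, extAction_polyHom,
        LinearMap.add_apply, Module.End.mul_apply, actS_apply, actT_apply, map_one,
        LinearMap.mulLeft_apply, mul_one]
      -- As $f_j$ does not involve $s$, the shift fixes it, and the two terms are $\pm s_if_j/f_i$.
      change _ + _ * shiftL f L _ (fL f L j : L) = 0
      rw [shiftL_fL]
      ring
    · simp only [map_add, map_sum, map_mul, extAction_d, extAction_dt, extAction_polyHom,
        LinearMap.add_apply, LinearMap.sum_apply, Module.End.mul_apply, actD_apply, actT_apply,
        map_one, LinearMap.mulLeft_apply, mul_one, Derivation.map_one_eq_zero, zero_add, logDer,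
        toL_pderiv f L]
      rw [← Finset.sum_add_distrib]
      exact Finset.sum_eq_zero fun k _ => by ring

end Action

/-! ### Faithfulness of the normal forms -/

section Faithful

variable {K : Type*} [Field K] {n r : ℕ} (f : Fin r → MvPolynomial (Fin n) K)
  (hf : ∀ j, f j ≠ 0) (L : Type*) [CommRing L]
  [Algebra (MvPolynomial (Fin n ⊕ Fin r) K) L] [Algebra K L]
  [IsScalarTower K (MvPolynomial (Fin n ⊕ Fin r) K) L] [IsLocalization (fPow f) L]

/-! ### Specialization $s=v$ with values in $\mathbb{K}(x)$ -/

/-- The canonical homomorphism from `K[x]` to its fraction field `K(x)`. -/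
abbrev toFrac (K : Type*) [Field K] (n : ℕ) :
    MvPolynomial (Fin n) K →ₐ[K] FractionRing (MvPolynomial (Fin n) K) :=
  IsScalarTower.toAlgHom K _ _

/-- The substitution `G(x, s) ↦ G(x, v)` from `K[x, s]` to `K(x)`. -/
def evalP (v : Fin r → K) :
    MvPolynomial (Fin n ⊕ Fin r) K →ₐ[K] FractionRing (MvPolynomial (Fin n) K) :=
  MvPolynomial.aeval (Sum.elim (fun m => toFrac K n (MvPolynomial.X m)) fun i => algebraMap K _ (v i))

theorem evalP_rename (v : Fin r → K) (p : MvPolynomial (Fin n) K) :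
    evalP v (MvPolynomial.rename Sum.inl p) = toFrac K n p := by
  have : (evalP v).comp (MvPolynomial.rename Sum.inl) = toFrac K n :=
    MvPolynomial.algHom_ext fun m => by simp [evalP]
  exact congrArg (fun φ => φ p) this

include hf in
theorem toFrac_ne_zero (j : Fin r) : toFrac K n (f j) ≠ 0 :=
  (map_ne_zero_iff _ (IsFractionRing.injective _ _)).mpr (hf j)

include hf in
-- The specialization extends over $1/(f_1\cdots f_r)$ because each nonzero $f_j$ is invertible in
-- $\mathbb{K}(x)$, whatever $v$ is.
theorem evalP_isUnit (v : Fin r → K) (w : fPow f) : IsUnit (evalP (n := n) v w) := by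
  obtain ⟨w, k, rfl⟩ := w
  simp only [map_pow, map_prod, fXS, evalP_rename]
  exact ((Finset.prod_ne_zero_iff.mpr fun j _ => toFrac_ne_zero f hf j).isUnit).pow _

/-- The substitution `G(x, s) ↦ G(x, v)` from `K[x, s, 1/f]` to `K(x)`. -/
def evalL (v : Fin r → K) : L →ₐ[K] FractionRing (MvPolynomial (Fin n) K) :=
  IsLocalization.liftAlgHom (M := fPow f) (f := evalP v) (evalP_isUnit f hf v)

theorem evalL_toL (v : Fin r → K) (p : MvPolynomial (Fin n ⊕ Fin r) K) :
    evalL f hf L v (toL L p) = evalP v p :=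
  IsLocalization.lift_eq _ _

theorem evalL_sL (v : Fin r → K) (i : Fin r) :
    evalL f hf L v (sL f L i) = algebraMap K _ (v i) := by
  rw [sL, evalL_toL]
  simp [evalP]

theorem evalL_inv (v : Fin r → K) (j : Fin r) :
    evalL f hf L v ↑(fL f L j)⁻¹ = (toFrac K n (f j))⁻¹ := by
  apply eq_inv_of_mul_eq_one_left
  rw [← evalP_rename v, ← evalL_toL f hf L, ← fXS, ← fL_val, ← map_mul, Units.inv_mul, map_one]

theorem evalL_shiftL (v w : Fin r → K) (G : L) :
    evalL f hf L v (shiftL f L w G) = evalL f hf L (v + w) G := by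
  have : (evalL f hf L v).comp (shiftL f L w) = evalL f hf L (v + w) := by
    apply IsLocalization.algHom_ext (fPow f)
    apply MvPolynomial.algHom_ext
    rintro (m | i)
    · change evalL f hf L v (shiftL f L w (xL f L m)) = evalL f hf L (v + w) (xL f L m)
      rw [shiftL_xL, xL, evalL_toL, evalL_toL]
      simp [evalP]
    · change evalL f hf L v (shiftL f L w (sL f L i)) = evalL f hf L (v + w) (sL f L i)
      simp only [shiftL_sL, map_add, AlgHom.commutes, Pi.add_apply, evalL_sL]
  exact congrArg (fun φ => φ G) this

/-! ### Falling factorials as coefficients of $\partial t^\alpha\bullet f^s$ -/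

/-- The value at `s = v` of the coefficient of `∂t^α • f^s`. -/
def dtCoeff (v : Fin r → K) (α : Fin r →₀ ℕ) : FractionRing (MvPolynomial (Fin n) K) :=
  ∏ i, (algebraMap K _ ((-1) ^ α i * (descPochhammer K (α i)).eval (v i)) *
    (toFrac K n (f i))⁻¹ ^ α i)

/-- From $[v]_{a+1}=v\,[v-1]_a$ for falling factorials. This is the recursion obtained by applying
$\partial t_k$ once more: a factor $-v_k/f_k$ and a move of the evaluation point to $v-\epsilon_k$.
-/
theorem dtCoeff_add_single (v : Fin r → K) (α : Fin r →₀ ℕ) (k : Fin r) :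
    dtCoeff f v (α + Finsupp.single k 1) =
      -(algebraMap K _ (v k) * (toFrac K n (f k))⁻¹) * dtCoeff f (v + -Pi.single k 1) α := by
  rw [dtCoeff, dtCoeff, Fintype.prod_eq_mul_prod_compl k,
    Fintype.prod_eq_mul_prod_compl k (fun i => _ * (toFrac K n (f i))⁻¹ ^ α i), ← mul_assoc]
  congr 1
  · simp only [Finsupp.add_apply, Finsupp.single_eq_same, descPochhammer_succ_left, Pi.add_apply,
      Pi.neg_apply, Pi.single_eq_same, Polynomial.eval_mul, Polynomial.eval_X,
      Polynomial.eval_comp, Polynomial.eval_sub, Polynomial.eval_one, pow_succ, map_mul, map_neg,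
      map_one, ← sub_eq_add_neg]
    ring
  · refine Finset.prod_congr rfl fun i hi => ?_
    have hi : i ≠ k := by simpa using hi
    simp [hi]

theorem dtCoeff_zero (v : Fin r → K) : dtCoeff f v 0 = 1 := by simp [dtCoeff]

/-- If $\alpha_i>\beta_i$, the product $\beta_i(\beta_i-1)\cdots(\beta_i-\alpha_i+1)$ contains the
factor zero. -/
theorem dtCoeff_eq_zero {α β : Fin r →₀ ℕ} (h : ¬ α ≤ β) :
    dtCoeff f (fun i => (β i : K)) α = 0 := by
  obtain ⟨i, hi⟩ := not_forall.mp h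
  refine Finset.prod_eq_zero (Finset.mem_univ i) ?_
  rw [descPochhammer_eval_eq_descFactorial, Nat.descFactorial_of_lt (not_le.mp hi)]
  simp

include hf in
-- On the diagonal the falling factorials are $\beta_i!$. Characteristic zero enters the proof here.
theorem dtCoeff_self_ne_zero [CharZero K] (β : Fin r →₀ ℕ) :
    dtCoeff f (fun i => (β i : K)) β ≠ 0 := by
  refine Finset.prod_ne_zero_iff.mpr fun i _ => mul_ne_zero ?_
    (pow_ne_zero _ (inv_ne_zero (toFrac_ne_zero f hf i)))
  rw [descPochhammer_eval_eq_descFactorial, Nat.descFactorial_self, map_ne_zero]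
  exact mul_ne_zero (pow_ne_zero _ (neg_ne_zero.mpr one_ne_zero))
    (Nat.cast_ne_zero.mpr (Nat.factorial_ne_zero _))

/-- The homomorphism `K[x][y] → D_n⟨∂t, S⟩` with `y_k ↦ ∂t_k` and `x_m ↦ x_m`. -/
def iterSymbolHom (K : Type*) [Field K] (n r : ℕ) :
    MvPolynomial (Fin r) (MvPolynomial (Fin n) K) →ₐ[K] DntS K n r :=
  -- Collecting powers of $\partial t$ over $\mathbb{K}[x]$ makes a symbol act on $f^s$ as a
  -- $\mathbb{K}[x]$-combination of falling factorials.
  (symbolHom K n r).comp (MvPolynomial.sumAlgEquiv K (Fin r) (Fin n)).symm.toAlgHom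

theorem iterSymbolHom_X (k : Fin r) :
    iterSymbolHom K n r (MvPolynomial.X k) = gen K (.dt k) := by
  rw [← symbolHom_inl, iterSymbolHom]
  simp

theorem iterSymbolHom_C (a : MvPolynomial (Fin n) K) :
    iterSymbolHom K n r (MvPolynomial.C a) = polyHom K a := by
  have : (iterSymbolHom K n r).comp (IsScalarTower.toAlgHom K _ _) = polyHom K :=
    MvPolynomial.algHom_ext fun m => by
      simp [iterSymbolHom, MvPolynomial.algebraMap_eq, symbolHom_inr, polyHom_X]
  exact congrArg (fun φ => φ a) this

theorem evalL_monomial (α : Fin r →₀ ℕ) (v : Fin r → K) :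
    evalL f hf L v (extAction f L (iterSymbolHom K n r (MvPolynomial.monomial α 1)) 1) =
      dtCoeff f v α := by
  -- Passing from $\gamma$ to $\gamma+\alpha$ makes the claim additive in $\alpha$, as
  -- `Finsupp.induction_linear` requires. All $v$ are treated at once because each $\partial t_k$
  -- moves the evaluation point.
  suffices h : ∀ γ : Fin r →₀ ℕ,
      (∀ v, evalL f hf L v (extAction f L (iterSymbolHom K n r (MvPolynomial.monomial γ 1)) 1) =
        dtCoeff f v γ) → ∀ v, evalL f hf L v
        (extAction f L (iterSymbolHom K n r (MvPolynomial.monomial (γ + α) 1)) 1) =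
          dtCoeff f v (γ + α) by
    have := h 0 (fun v => ?_) v
    · rwa [zero_add] at this
    · rw [dtCoeff_zero, ← MvPolynomial.C_apply]
      simp
  clear v
  induction α using Finsupp.induction_linear with
  | zero => intro γ h; rwa [add_zero]
  | add α β hα hβ =>
    intro γ h
    rw [← add_assoc]
    exact hβ _ (hα _ h)
  | single k a =>
    intro γ h
    induction a with
    | zero => rwa [Finsupp.single_zero, add_zero]
    | succ a ih =>
      intro v
      rw [Finsupp.single_add, ← add_assoc, dtCoeff_add_single, ← ih, MvPolynomial.monomial_add_single,
        pow_one, mul_comm, map_mul, map_mul, iterSymbolHom_X, extAction_dt, Module.End.mul_apply, actT_apply,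
        map_mul, evalL_shiftL, map_neg, map_mul, evalL_sL, evalL_inv]

theorem evalL_iterSymbolHom (q : MvPolynomial (Fin r) (MvPolynomial (Fin n) K)) (v : Fin r → K) :
    evalL f hf L v (extAction f L (iterSymbolHom K n r q) 1) =
      ∑ α ∈ q.support, toFrac K n (q.coeff α) * dtCoeff f v α := by
  conv_lhs => rw [q.as_sum]
  simp only [map_sum, LinearMap.sum_apply]
  refine Finset.sum_congr rfl fun α _ => ?_
  rw [← mul_one (q.coeff α), ← MvPolynomial.C_mul_monomial, map_mul, map_mul, iterSymbolHom_C,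
    extAction_polyHom, Module.End.mul_apply, LinearMap.mulLeft_apply, map_mul, evalL_toL,
    evalP_rename, evalL_monomial, mul_one]

include hf in
-- Triangularity: evaluated at $s=\beta$ for a minimal exponent $\beta$ of $q$, only exponents
-- $\alpha\le\beta$ contribute, hence only $\beta$ itself. The surviving term is the coefficient of
-- $\beta$ times a nonzero element of $\mathbb{K}(x)$.
theorem eq_zero_of_extAction_iterSymbolHom [CharZero K]
    {q : MvPolynomial (Fin r) (MvPolynomial (Fin n) K)}
    (h : extAction f L (iterSymbolHom K n r q) 1 = 0) : q = 0 := by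
  by_contra hq
  obtain ⟨β, hβ⟩ := q.support.exists_minimal (MvPolynomial.support_nonempty.mpr hq)
  have := evalL_iterSymbolHom f hf L q (fun i => (β i : K))
  rw [h, map_zero, Finset.sum_eq_single_of_mem β hβ.1 fun α hα hne => ?_] at this
  · exact mul_ne_zero ((map_ne_zero_iff _ (IsFractionRing.injective _ _)).mpr
      (MvPolynomial.mem_support_iff.mp hβ.1)) (dtCoeff_self_ne_zero f hf β) this.symm
  · rw [dtCoeff_eq_zero f fun hle => hne (le_antisymm hle (hβ.2 hα hle)), mul_zero]

include hf in
theorem eq_zero_of_extAction_symbolHom [CharZero K] {p : MvPolynomial (Fin r ⊕ Fin n) K}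
    (h : extAction f L (symbolHom K n r p) 1 = 0) : p = 0 := by
  rw [← EmbeddingLike.map_eq_zero_iff (f := MvPolynomial.sumAlgEquiv K (Fin r) (Fin n))]
  apply eq_zero_of_extAction_iterSymbolHom f hf L
  simpa [iterSymbolHom] using h

include hf in
/-- The annihilator of `f^s` in `D_n⟨∂t, S⟩` is `bmIdeal`. -/
theorem extAction_one_eq_zero_iff [CharZero K] (P : DntS K n r) :
    extAction f L P 1 = 0 ↔ P ∈ bmIdeal f := by
  refine ⟨fun h => ?_, extAction_one_eq_zero f L⟩
  -- The normal form $p$ of $P$ differs from it by an element killing $f^s$, so it kills $f^s$ as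
  -- well and vanishes by faithfulness.
  obtain ⟨p, hp⟩ := exists_sub_symbolHom_mem f P
  have h0 := extAction_one_eq_zero f L hp
  rw [map_sub, LinearMap.sub_apply, h, zero_sub, neg_eq_zero] at h0
  rwa [eq_zero_of_extAction_symbolHom f hf L h0, map_zero, sub_zero] at hp

end Faithful

end BMVar

end

/-! ### The annihilator in $D_n\langle S\rangle$ -/

theorem theorem8p3 {K : Type*} [Field K] [CharZero K] {n r : ℕ}
    (f : Fin r → MvPolynomial (Fin n) K) (hf : ∀ j, f j ≠ 0) :
    BMVar.annFs f = (BMVar.bmIdeal f).comap (BMVar.incl K n r) := by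
  ext P
  -- The preimage under `incl` is the intersection with $D_n\langle S\rangle$, in view of
  -- `incl_injective`. Along `incl` the extended action is the original one, so both sides state
  -- that $P$ kills $f^s$.
  rw [Ideal.mem_comap, ← BMVar.extAction_one_eq_zero_iff f hf (Localization (BMVar.fPow f)),
    BMVar.extAction_incl]
  rfl
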